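/- Let $\mathbb N=\{0,1,2,\ldots\}$ and $\mathbb Z^+=\{1,2,3,\ldots\}$. Call a polynomial $P(x,y,z,w)$ with integer coefficients *suitable* if every $n\in\mathbb N$ can be written as $n=x^2+y^2+z^2+w^2$ with $x,y,z,w\in\mathbb N$ such that $P(x,y,z,w)$ is the square of an integer. (i) The polynomial $x^2+8yz$ is suitable, i.e., every $n\in\mathbb N$ can be written as $n=x^2+y^2+z^2+w^2$ with $x,y,z,w\in\mathbb N$ such that $x^2+8yz$ is a square. (ii) The polynomial $x+2y$ is suitable. Moreover, every $n\in\mathbb Z^+$ can be written as $n=x^2+y^2+z^2+w^2$ with $x,y,z,w\in\mathbb N$ such that $x+2y=k^2$ for some $k\in\mathbb Z^+$. -/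

import Mathlib

/-- A polynomial `P(x,y,z,w)` with integer coefficients (the variables `X 0, X 1, X 2, X 3`
stand for `x, y, z, w`) is suitable if every natural number can be written as
`x² + y² + z² + w²` with `x, y, z, w` natural numbers such that the integer `P(x,y,z,w)`
is a square. -/
def IsSuitable (P : MvPolynomial (Fin 4) ℤ) : Prop :=
  ∀ n : ℕ, ∃ x y z w : ℕ, n = x ^ 2 + y ^ 2 + z ^ 2 + w ^ 2 ∧
    IsSquare (MvPolynomial.eval (![(x : ℤ), (y : ℤ), (z : ℤ), (w : ℤ)] : Fin 4 → ℤ) P)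

/-!
Both parts rest on the Gauss–Legendre three-square theorem `eq_four_pow_mul_or_sum_three_sq`,
proved as follows. A positive definite integral ternary form of determinant one takes only sums of
three squares as values (`ternary_value_eq_sum_three_sq`, by reduction theory). Such a form with
value `n` exists as soon as `-d` is a square modulo `d n - 1` for some `d > 0`
(`sum_three_sq_of_dvd`), and Dirichlet's theorem on primes in arithmetic progressions together with
quadratic reciprocity supplies a suitable `d`.

For `x² + 8 y z`: if `n` is a sum of three squares, take `y = 0`. Otherwise, after scaling,
`n = 8 b + 7`; the three-square theorem applied to `6 n` gives `n = w² + 2 q² + 3 p²`, and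
`(x, y, z) = (|p - q|, p + q, p)` works since `(p - q)² + 8 p (p + q) = (3 p + q)²`.

For `x + 2 y`: since `(x + 2 y)² + (2 x - y)² = 5 (x² + y²)`, the equation `x + 2 y = k²` leads to
`5 n - k ^ 4 = u² + 5 v² + 5 w²` with `u = 2 x - y`. Any sum of three squares that is `0` or `-1`
modulo `5` has this shape, and `4 n ≤ k ^ 4 ≤ 5 n` makes `x` and `y` nonnegative. One may assume
that `16` does not divide `n`, since multiplying `x, y, z, w` by `4` replaces `k` by `2 k`; then one
parity of `k` guarantees that `5 n - k ^ 4` is a sum of three squares. Such a `k` exists when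
`n ≥ 419905`, and smaller `n` are covered by a computation
(`squareLineMask_or_sixteenMask_mod`).
-/

/-! ### Reduction of ternary quadratic forms of determinant one -/

lemma exists_abs_two_mul_add_mul_le {a : ℤ} (ha : 0 < a) (b : ℤ) :
    ∃ t : ℤ, |2 * (b + a * t)| ≤ a := by
  refine ⟨-((2 * b + a) / (2 * a)), ?_⟩
  have h1 := Int.mul_ediv_add_emod (2 * b + a) (2 * a)
  have h2 := Int.emod_nonneg (2 * b + a) (by positivity : 2 * a ≠ 0)
  have h3 := Int.emod_lt_of_pos (2 * b + a) (by positivity : 0 < 2 * a)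
  rw [abs_le]
  constructor <;> linarith

/-- Reduction of a positive definite binary form `a x² + 2 b x y + c y²`: after a unimodular
substitution with first column `(p, r)`, the leading coefficient is at most `2 / √3` times the
square root of the discriminant `a c - b²`. -/
lemma exists_unimodular_leading_coeff_le (a b c : ℤ) (ha : 0 < a) (hd : 0 < a * c - b ^ 2) :
    ∃ p q r s : ℤ, p * s - q * r = 1 ∧
      3 * (a * p ^ 2 + 2 * b * p * r + c * r ^ 2) ^ 2 ≤ 4 * (a * c - b ^ 2) := by
  induction h : a.toNat using Nat.strong_induction_on generalizing a b c with
  | _ N ih =>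
    obtain ⟨t, ht⟩ := exists_abs_two_mul_add_mul_le ha b
    set b' := b + a * t with hb'
    set c' := c + 2 * b * t + a * t ^ 2 with hc'
    have hdisc : a * c' - b' ^ 2 = a * c - b ^ 2 := by rw [hb', hc']; ring
    have hc'_pos : 0 < c' := by
      have : 0 < a * c' := by nlinarith [sq_nonneg b']
      exact pos_of_mul_pos_right this ha.le
    rcases lt_or_ge c' a with hlt | hge
    · -- Translate by `t` and exchange the variables to lower the leading coefficient to `c'`.
      obtain ⟨p, q, r, s, hdet, hle⟩ :=
        ih c'.toNat (by omega) c' (-b') a hc'_pos (by linarith) rfl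
      refine ⟨t * p - r, t * q - s, p, q, by linear_combination hdet, ?_⟩
      have h1 : a * (t * p - r) ^ 2 + 2 * b * (t * p - r) * p + c * p ^ 2 =
          c' * p ^ 2 + 2 * -b' * p * r + a * r ^ 2 := by rw [hb', hc']; ring
      rw [h1]
      linarith
    · refine ⟨1, 0, 0, 1, by norm_num, ?_⟩
      have h1 : (2 * b') ^ 2 ≤ a ^ 2 := sq_le_sq.2 (by rwa [abs_of_pos ha])
      nlinarith

/-- Every value of a positive definite integral ternary form of determinant one (with even
off-diagonal coefficients) is a sum of three squares. The proof is by descent on the leading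
coefficient `a`: reducing the binary form in `y, z` and translating `x` either produces a smaller
diagonal coefficient, or makes the form visibly a sum of three squares. -/
lemma ternary_value_eq_sum_three_sq (a b c d e f : ℤ) (ha : 0 < a) (hab : 0 < a * b - f ^ 2)
    (hdet : a * b * c + 2 * d * e * f - a * d ^ 2 - b * e ^ 2 - c * f ^ 2 = 1) (x y z : ℤ) :
    ∃ u v w : ℤ, a * x ^ 2 + b * y ^ 2 + c * z ^ 2 + 2 * d * y * z + 2 * e * x * z +
      2 * f * x * y = u ^ 2 + v ^ 2 + w ^ 2 := by
  induction h : a.toNat using Nat.strong_induction_on generalizing a b c d e f x y z with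
  | _ N ih =>
    -- The binary form left over after completing the square in `x` has discriminant `a`.
    have hdisc : (a * b - f ^ 2) * (a * c - e ^ 2) - (a * d - e * f) ^ 2 = a := by
      linear_combination a * hdet
    obtain ⟨p, q, r, s, hps, hle⟩ := exists_unimodular_leading_coeff_le (a * b - f ^ 2)
      (a * d - e * f) (a * c - e ^ 2) hab (by rwa [hdisc])
    rw [hdisc] at hle
    -- The coefficients with index `1` arise from `y = p y' + q z'`, `z = r y' + s z'`,
    -- those with index `2` from a further translation `x = x' + t y'`.
    set b₁ := b * p ^ 2 + 2 * d * p * r + c * r ^ 2 with hb₁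
    set c₁ := b * q ^ 2 + 2 * d * q * s + c * s ^ 2 with hc₁
    set d₁ := b * p * q + d * (p * s + q * r) + c * r * s with hd₁
    set e₁ := e * s + f * q with he₁
    set f₁ := f * p + e * r with hf₁
    obtain ⟨t, ht⟩ := exists_abs_two_mul_add_mul_le ha f₁
    set f₂ := f₁ + a * t with hf₂
    set b₂ := b₁ + 2 * f₁ * t + a * t ^ 2 with hb₂
    set d₂ := d₁ + e₁ * t with hd₂
    have hdet₂ : a * b₂ * c₁ + 2 * d₂ * e₁ * f₂ - a * d₂ ^ 2 - b₂ * e₁ ^ 2 - c₁ * f₂ ^ 2 = 1 := by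
      have : a * b₂ * c₁ + 2 * d₂ * e₁ * f₂ - a * d₂ ^ 2 - b₂ * e₁ ^ 2 - c₁ * f₂ ^ 2 =
          (p * s - q * r) ^ 2 *
            (a * b * c + 2 * d * e * f - a * d ^ 2 - b * e ^ 2 - c * f ^ 2) := by
        rw [hd₂, hb₂, hf₂, hf₁, he₁, hd₁, hc₁, hb₁]; ring
      rw [this, hps, hdet]; norm_num
    have hval : a * x ^ 2 + b * y ^ 2 + c * z ^ 2 + 2 * d * y * z + 2 * e * x * z + 2 * f * x * y =
        a * (x - t * (s * y - q * z)) ^ 2 + b₂ * (s * y - q * z) ^ 2 + c₁ * (p * z - r * y) ^ 2 +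
          2 * d₂ * (s * y - q * z) * (p * z - r * y) +
          2 * e₁ * (x - t * (s * y - q * z)) * (p * z - r * y) +
          2 * f₂ * (x - t * (s * y - q * z)) * (s * y - q * z) := by
      have hy : y = p * (s * y - q * z) + q * (p * z - r * y) := by
        linear_combination (-y) * hps
      have hz : z = r * (s * y - q * z) + s * (p * z - r * y) := by
        linear_combination (-z) * hps
      generalize s * y - q * z = y' at hy hz ⊢
      generalize p * z - r * y = z' at hy hz ⊢
      rw [hy, hz, hd₂, hb₂, hf₂, hf₁, he₁, hd₁, hc₁, hb₁]; ring
    -- The translation in `x` does not change the leading `2 × 2` minor.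
    have hG : a * b₂ - f₂ ^ 2 = (a * b - f ^ 2) * p ^ 2 + 2 * (a * d - e * f) * p * r +
        (a * c - e ^ 2) * r ^ 2 := by
      rw [hb₂, hf₂, hf₁, hb₁]; ring
    rw [← hG] at hle
    have hGpos : 0 < a * b₂ - f₂ ^ 2 := by
      have h1 : (a * b - f ^ 2) * (a * b₂ - f₂ ^ 2) =
          ((a * b - f ^ 2) * p + (a * d - e * f) * r) ^ 2 + a * r ^ 2 := by
        rw [hG]; linear_combination r ^ 2 * hdisc
      refine pos_of_mul_pos_right (a := a * b - f ^ 2) ?_ hab.le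
      rw [h1]
      by_cases hr : r = 0
      · have hp : p ≠ 0 := by rintro rfl; simp [hr] at hps
        have : (a * b - f ^ 2) * p ≠ 0 := mul_ne_zero hab.ne' hp
        rw [hr, mul_zero, add_zero]
        exact add_pos_of_pos_of_nonneg (sq_pos_of_ne_zero this) (by simp)
      · positivity
    have hb₂_pos : 0 < b₂ := by
      have : 0 < a * b₂ := by linarith [sq_nonneg f₂]
      exact pos_of_mul_pos_right this ha.le
    rw [hval]
    clear_value b₂ c₁ d₂ e₁ f₂
    clear hval hG hf₂ hb₂ hd₂ hb₁ hc₁ hd₁ he₁ hf₁ hdisc hdet hab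
    generalize x - t * (s * y - q * z) = x'
    generalize s * y - q * z = y'
    generalize p * z - r * y = z'
    rcases lt_or_ge b₂ a with hlt | hge
    · obtain ⟨u, v, w, huvw⟩ := ih b₂.toNat (by omega) b₂ a c₁ e₁ d₂ f₂ hb₂_pos (by linarith)
        (by linear_combination hdet₂) y' x' z' rfl
      exact ⟨u, v, w, by rw [← huvw]; ring⟩
    · -- Now `3 a² ≤ 4 G` and `3 G² ≤ 4 a` for the leading `2 × 2` minor `G`; hence `a = 1`,
      -- then `f₂ = 0` and `b₂ = G = 1`, and completing the square leaves `z'²`.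
      have h1 : (2 * f₂) ^ 2 ≤ a ^ 2 := sq_le_sq.2 (by rwa [abs_of_pos ha])
      have h2 : 3 * a ^ 2 ≤ 4 * (a * b₂ - f₂ ^ 2) := by
        linarith [mul_le_mul_of_nonneg_left hge ha.le]
      have ha1 : a = 1 := by
        by_contra hne
        have h3 : 2 ≤ a := by omega
        have h4 : (3 * a ^ 2) ^ 2 ≤ (4 * (a * b₂ - f₂ ^ 2)) ^ 2 :=
          pow_le_pow_left₀ (by positivity) h2 2
        have h5 : 27 * a ^ 4 ≤ 64 * a := by linarith
        have h6 : 8 ≤ a ^ 3 := by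
          calc (8 : ℤ) = 2 ^ 3 := by norm_num
            _ ≤ a ^ 3 := pow_le_pow_left₀ (by norm_num) h3 3
        linarith [mul_le_mul_of_nonneg_left h6 ha.le]
      have hf0 : f₂ = 0 := by rw [ha1, abs_le] at ht; omega
      rw [ha1, hf0] at hle hGpos hdet₂
      have hb1 : b₂ = 1 := by nlinarith
      rw [hb1] at hdet₂
      refine ⟨x' + e₁ * z', y' + d₂ * z', z', ?_⟩
      rw [ha1, hf0, hb1]
      linear_combination z' ^ 2 * hdet₂

/-- If `-d` is a quadratic residue modulo `d n - 1`, then `n` is a value of a positive definite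
ternary form of determinant one, with diagonal `(t² + d) / (d n - 1), d n - 1, n`. -/
lemma sum_three_sq_of_dvd {n d t : ℤ} (hd : 0 < d) (hnd : 0 < d * n - 1)
    (h : d * n - 1 ∣ t ^ 2 + d) : ∃ u v w : ℤ, n = u ^ 2 + v ^ 2 + w ^ 2 := by
  obtain ⟨a, ha⟩ := h
  have ha_pos : 0 < a := pos_of_mul_pos_right (ha ▸ by positivity) hnd.le
  obtain ⟨u, v, w, h⟩ := ternary_value_eq_sum_three_sq a (d * n - 1) n 0 1 t ha_pos
    (by linarith) (by linear_combination (-n) * ha) 0 0 1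
  exact ⟨u, v, w, by linear_combination h⟩

/-! ### The three-square theorem -/

open NumberTheorySymbols

lemma exists_dvd_sq_add {p d : ℕ} (hp : p.Prime) (h : J(-(d : ℤ) | p) = 1) :
    ∃ t : ℤ, (p : ℤ) ∣ t ^ 2 + d := by
  have := Fact.mk hp
  obtain ⟨t, ht⟩ := ZMod.isSquare_of_jacobiSym_eq_one h
  refine ⟨t.val, ?_⟩
  rw [← ZMod.intCast_zmod_eq_zero_iff_dvd]
  push_cast at ht ⊢
  rw [ZMod.natCast_zmod_val, pow_two, ← ht]
  ring

/-- A prime `p = (4 j + 1) n - 1` is `1` modulo `4`, so with `d = 4 j + 1` quadratic reciprocity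
gives `(-d / p) = (p / d) = (-1 / d) = 1`. -/
lemma sum_three_sq_of_mod_four_eq_two {n : ℕ} (hn : n % 4 = 2) :
    ∃ u v w : ℤ, (n : ℤ) = u ^ 2 + v ^ 2 + w ^ 2 := by
  have hcop : (n - 1).Coprime (4 * n) := by
    refine Nat.Coprime.mul_right ?_ ?_
    · exact Nat.Coprime.pow_right 2 (Nat.coprime_two_right.2 (Nat.odd_iff.2 (by omega)))
    · exact (Nat.coprime_self_sub_left (by omega)).2 (by simp)
  obtain ⟨p, hpn, hp, hmod⟩ :=
    Nat.forall_exists_prime_gt_and_modEq (4 * n) (by omega : 4 * n ≠ 0) hcop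
  obtain ⟨j, hj⟩ := (Nat.modEq_iff_dvd' (by omega)).1 hmod.symm
  have hpd : (p : ℤ) = ((4 * j + 1 : ℕ) : ℤ) * n - 1 := by
    have h1 : p = 4 * n * j + (n - 1) := by omega
    zify [(by omega : 1 ≤ n)] at h1
    push_cast
    linear_combination h1
  have hp4 : p % 4 = 1 := by
    have h1 : p = 4 * (n * j) + (n - 1) := by rw [← mul_assoc]; omega
    omega
  have hodd : Odd (4 * j + 1) := by simp [parity_simps]
  obtain ⟨t, ht⟩ := exists_dvd_sq_add (d := 4 * j + 1) hp (by
    rw [jacobiSym.neg _ (Nat.odd_iff.2 (by omega)), ZMod.χ₄_nat_one_mod_four hp4, one_mul,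
      jacobiSym.quadratic_reciprocity_one_mod_four (by omega) (Nat.odd_iff.2 (by omega)),
      jacobiSym.mod_left' (a₂ := -1), jacobiSym.at_neg_one hodd,
      ZMod.χ₄_nat_one_mod_four (by omega)]
    rw [hpd, sub_eq_add_neg, Int.mul_add_emod_self_left])
  exact sum_three_sq_of_dvd (d := (4 * j + 1 : ℕ)) (by positivity)
    (by rw [← hpd]; exact_mod_cast hp.pos) (by rwa [← hpd])

/-- Here `2 p = d n - 1` with `p` prime and `d = 8 j + c`. The choice of `c` makes `(c n - 1) / 2`
odd and `-2` a residue for `d`, so that `(-d / p) = (p / d) = (-2 / d) = 1`. -/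
lemma sum_three_sq_of_odd {n c : ℕ} (hc : n % 8 = 1 ∧ c = 3 ∨ n % 8 = 3 ∧ c = 1 ∨
    n % 8 = 5 ∧ c = 3) : ∃ u v w : ℤ, (n : ℤ) = u ^ 2 + v ^ 2 + w ^ 2 := by
  obtain ⟨m, hm⟩ : ∃ m, c * n = 2 * m + 1 := ⟨(c * n - 1) / 2, by
    rcases hc with ⟨h, rfl⟩ | ⟨h, rfl⟩ | ⟨h, rfl⟩ <;> omega⟩
  have hcop : m.Coprime (4 * n) := by
    refine Nat.Coprime.mul_right ?_ ?_
    · refine Nat.Coprime.pow_right 2 (Nat.coprime_two_right.2 (Nat.odd_iff.2 ?_))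
      rcases hc with ⟨h, rfl⟩ | ⟨h, rfl⟩ | ⟨h, rfl⟩ <;> omega
    · refine Nat.isCoprime_iff_coprime.1 ⟨-2, c, ?_⟩
      zify at hm
      linear_combination hm
  have hn0 : 4 * n ≠ 0 := by
    rcases hc with ⟨h, rfl⟩ | ⟨h, rfl⟩ | ⟨h, rfl⟩ <;> omega
  have hmn : m < 4 * n := by
    rcases hc with ⟨h, rfl⟩ | ⟨h, rfl⟩ | ⟨h, rfl⟩ <;> omega
  obtain ⟨p, hpn, hp, hmod⟩ := Nat.forall_exists_prime_gt_and_modEq (4 * n) hn0 hcop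
  obtain ⟨j, hj⟩ := (Nat.modEq_iff_dvd' (by omega)).1 hmod.symm
  have hpj : p = 4 * (n * j) + m := by rw [← mul_assoc]; omega
  have hpd : 2 * (p : ℤ) = ((8 * j + c : ℕ) : ℤ) * n - 1 := by
    zify at hpj hm
    push_cast
    linear_combination 2 * hpj - hm
  have hpodd : Odd p := by
    rw [Nat.odd_iff]
    rcases hc with ⟨h, rfl⟩ | ⟨h, rfl⟩ | ⟨h, rfl⟩ <;> omega
  have hdodd : Odd (8 * j + c) := by
    rw [Nat.odd_iff]
    rcases hc with ⟨h, rfl⟩ | ⟨h, rfl⟩ | ⟨h, rfl⟩ <;> omega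
  have hJ : J((p : ℤ) | 8 * j + c) = 1 := by
    have h1 : J(-2 | 8 * j + c) = 1 := by
      rw [jacobiSym.at_neg_two hdodd, ZMod.χ₈'_nat_eq_if_mod_eight]
      rcases hc with ⟨h, rfl⟩ | ⟨h, rfl⟩ | ⟨h, rfl⟩ <;> norm_num [Nat.mul_add_mod]
        <;> omega
    have h2 : J(-2 * p | 8 * j + c) = 1 := by
      rw [jacobiSym.mod_left' (a₂ := 1), jacobiSym.one_left]
      rw [show -2 * (p : ℤ) = 1 + ((8 * j + c : ℕ) : ℤ) * -n by linear_combination -hpd,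
        Int.add_mul_emod_self_left]
    rwa [jacobiSym.mul_left, h1, one_mul] at h2
  have hJ' : J(-((8 * j + c : ℕ) : ℤ) | p) = 1 := by
    rw [jacobiSym.neg _ hpodd]
    rcases (by rcases hc with ⟨h, rfl⟩ | ⟨h, rfl⟩ | ⟨h, rfl⟩ <;> omega :
      p % 4 = 1 ∨ p % 4 = 3 ∧ (8 * j + c) % 4 = 3) with hp4 | ⟨hp4, hd4⟩
    · rw [ZMod.χ₄_nat_one_mod_four hp4, one_mul,
        jacobiSym.quadratic_reciprocity_one_mod_four' hdodd hp4, hJ]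
    · rw [ZMod.χ₄_nat_three_mod_four hp4,
        jacobiSym.quadratic_reciprocity_three_mod_four hd4 hp4, hJ]
      norm_num
  obtain ⟨t, ht⟩ := exists_dvd_sq_add hp hJ'
  -- Lift the root from modulus `p` to modulus `2 p` by making it odd.
  obtain ⟨s, hs2, hsp⟩ : ∃ s : ℤ, 2 ∣ s ^ 2 + ((8 * j + c : ℕ) : ℤ) ∧
      (p : ℤ) ∣ s ^ 2 + ((8 * j + c : ℕ) : ℤ) := by
    have hd' : Odd ((8 * j + c : ℕ) : ℤ) := by exact_mod_cast hdodd
    have hp' : Odd (p : ℤ) := by exact_mod_cast hpodd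
    rcases Int.even_or_odd t with h | h
    · refine ⟨t + p, even_iff_two_dvd.1 ((h.add_odd hp').pow.add_odd hd'), ?_⟩
      rw [show (t + p) ^ 2 + ((8 * j + c : ℕ) : ℤ) =
        t ^ 2 + ((8 * j + c : ℕ) : ℤ) + p * (2 * t + p) by ring]
      exact dvd_add ht (dvd_mul_right _ _)
    · exact ⟨t, even_iff_two_dvd.1 (h.pow.add_odd hd'), ht⟩
  refine sum_three_sq_of_dvd (d := (8 * j + c : ℕ)) (t := s)
    (by exact_mod_cast hdodd.pos) (by rw [← hpd]; exact_mod_cast Nat.mul_pos two_pos hp.pos) ?_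
  rw [← hpd]
  exact IsCoprime.mul_dvd (by
    rw [← Nat.cast_two, Nat.isCoprime_iff_coprime]
    exact Nat.coprime_two_left.2 hpodd) hs2 hsp

/-- The Gauss–Legendre three-square theorem. -/
theorem eq_four_pow_mul_or_sum_three_sq (n : ℕ) :
    (∃ a b, n = 4 ^ a * (8 * b + 7)) ∨ ∃ u v w : ℕ, n = u ^ 2 + v ^ 2 + w ^ 2 := by
  induction n using Nat.strong_induction_on with
  | _ n ih =>
    by_cases h4 : n % 4 = 0
    · obtain ⟨m, rfl⟩ := Nat.dvd_of_mod_eq_zero h4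
      rcases Nat.eq_zero_or_pos m with rfl | hm
      · exact Or.inr ⟨0, 0, 0, rfl⟩
      rcases ih m (by omega) with ⟨a, b, rfl⟩ | ⟨u, v, w, rfl⟩
      · exact Or.inl ⟨a + 1, b, by ring⟩
      · exact Or.inr ⟨2 * u, 2 * v, 2 * w, by ring⟩
    by_cases h7 : n % 8 = 7
    · exact Or.inl ⟨0, n / 8, by omega⟩
    have key : ∃ u v w : ℤ, (n : ℤ) = u ^ 2 + v ^ 2 + w ^ 2 := by
      rcases (by omega : n % 4 = 2 ∨ n % 8 = 1 ∨ n % 8 = 3 ∨ n % 8 = 5) with h | h | h | h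
      · exact sum_three_sq_of_mod_four_eq_two h
      · exact sum_three_sq_of_odd (c := 3) (by omega)
      · exact sum_three_sq_of_odd (c := 1) (by omega)
      · exact sum_three_sq_of_odd (c := 3) (by omega)
    obtain ⟨u, v, w, h⟩ := key
    refine Or.inr ⟨u.natAbs, v.natAbs, w.natAbs, ?_⟩
    zify
    simpa only [sq_abs] using h

/-! ### Squares of the form `x² + 8 y z` -/

lemma exists_sq_eq_mod_three (a : ℤ) :
    ∃ b : ℤ, b ^ 2 = a ^ 2 ∧ b % 2 = a % 2 ∧ (b % 3 = 0 ∨ b % 3 = 1) := by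
  rcases (by omega : a % 3 = 2 ∨ a % 3 = 0 ∨ a % 3 = 1) with h | h
  · exact ⟨-a, by ring, by omega, by omega⟩
  · exact ⟨a, rfl, rfl, h⟩

/-- The identity behind this is
`6 (w² + 2 q² + 3 p²) = (2 q + 2 w)² + (2 q - w + 3 p)² + (2 q - w - 3 p)²`. -/
lemma exists_eq_sq_add_two_mul_sq_add_three_mul_sq_of_mod_two_eq {n A B C : ℤ}
    (h : 6 * n = A ^ 2 + B ^ 2 + C ^ 2) (hBC : B % 2 = C % 2) :
    ∃ w q p : ℤ, n = w ^ 2 + 2 * q ^ 2 + 3 * p ^ 2 := by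
  obtain ⟨A', hA, hA2, hA3⟩ := exists_sq_eq_mod_three A
  obtain ⟨B', hB, hB2, hB3⟩ := exists_sq_eq_mod_three B
  obtain ⟨C', hC, hC2, hC3⟩ := exists_sq_eq_mod_three C
  rw [← hA, ← hB, ← hC] at h
  rw [← hB2, ← hC2] at hBC
  -- Up to signs, `A`, `B`, `C` are congruent modulo `3`, because the sum of their squares is `0`
  -- modulo `3`; this is what makes `q = (A + B + C) / 6` and `p = (B - C) / 6` integral.
  clear hA hB hC hA2 hB2 hC2
  have sq3 : ∀ a : ℤ, a % 3 = 0 ∨ a % 3 = 1 → a ^ 2 % 3 = a % 3 := by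
    rintro a (ha | ha) <;> simp [pow_two, Int.mul_emod, ha]
  have sq2 : ∀ a : ℤ, a ^ 2 % 2 = a % 2 := by
    intro a
    rcases Int.emod_two_eq_zero_or_one a with ha | ha <;> simp [pow_two, Int.mul_emod, ha]
  have hsA := sq3 A' hA3
  have hsB := sq3 B' hB3
  have hsC := sq3 C' hC3
  have := sq2 A'
  have := sq2 B'
  have := sq2 C'
  have h2 : (A' + B' + C') % 2 = 0 := by omega
  have h3 : A' % 3 = B' % 3 ∧ B' % 3 = C' % 3 := by
    clear * - h hsA hsB hsC hA3 hB3 hC3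
    rcases hA3 with hA | hA <;> rcases hB3 with hB | hB <;> rcases hC3 with hC | hC <;>
      rw [hA] at hsA <;> rw [hB] at hsB <;> rw [hC] at hsC <;> omega
  clear * - h hBC h2 h3
  obtain ⟨s, hs⟩ : ∃ s, A' + B' + C' = 6 * s := ⟨(A' + B' + C') / 6, by omega⟩
  obtain ⟨d, hd⟩ : ∃ d, B' - C' = 6 * d := ⟨(B' - C') / 6, by omega⟩
  obtain ⟨g, hg⟩ : ∃ g, A' = 2 * g := ⟨A' / 2, by omega⟩
  have hB : B' = 3 * s - g + 3 * d := by omega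
  have hC : C' = 3 * s - g - 3 * d := by omega
  refine ⟨g - s, s, d, ?_⟩
  rw [hg, hB, hC] at h
  linarith

lemma exists_eq_sq_add_two_mul_sq_add_three_mul_sq {n : ℕ} (hn : n % 2 = 1) :
    ∃ w q p : ℕ, n = w ^ 2 + 2 * q ^ 2 + 3 * p ^ 2 := by
  obtain ⟨A, B, C, h⟩ := sum_three_sq_of_mod_four_eq_two (n := 6 * n) (by omega)
  push_cast at h
  obtain ⟨w, q, p, h⟩ : ∃ w q p : ℤ, (n : ℤ) = w ^ 2 + 2 * q ^ 2 + 3 * p ^ 2 := by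
    rcases (by omega : B % 2 = C % 2 ∨ C % 2 = A % 2 ∨ A % 2 = B % 2) with h2 | h2 | h2
    · exact exists_eq_sq_add_two_mul_sq_add_three_mul_sq_of_mod_two_eq h h2
    · exact exists_eq_sq_add_two_mul_sq_add_three_mul_sq_of_mod_two_eq
        (A := B) (by rw [h]; ring) h2
    · exact exists_eq_sq_add_two_mul_sq_add_three_mul_sq_of_mod_two_eq
        (A := C) (by rw [h]; ring) h2
  refine ⟨w.natAbs, q.natAbs, p.natAbs, ?_⟩
  zify
  simpa only [sq_abs] using h

theorem exists_sum_four_sq_isSquare_sq_add_eight_mul (n : ℕ) :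
    ∃ x y z w : ℕ, n = x ^ 2 + y ^ 2 + z ^ 2 + w ^ 2 ∧ IsSquare (x ^ 2 + 8 * y * z) := by
  rcases eq_four_pow_mul_or_sum_three_sq n with ⟨a, b, rfl⟩ | ⟨u, v, w, rfl⟩
  · -- With `x = |p - q|`, `y = p + q`, `z = p` one has `x² + 8 y z = (3 p + q)²` and
    -- `x² + y² + z² = 3 p² + 2 q²`.
    obtain ⟨w, q, p, h⟩ := exists_eq_sq_add_two_mul_sq_add_three_mul_sq
      (n := 8 * b + 7) (by omega)
    obtain ⟨x, hx⟩ : ∃ x : ℕ, (x : ℤ) ^ 2 = (p - q) ^ 2 := ⟨_, Int.natAbs_sq (p - q)⟩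
    refine ⟨2 ^ a * x, 2 ^ a * (p + q), 2 ^ a * p, 2 ^ a * w, ?_, 2 ^ a * (3 * p + q), ?_⟩
    · rw [h, show (4 : ℕ) = 2 ^ 2 from rfl]
      zify
      rw [mul_pow _ (x : ℤ), hx, ← pow_mul]
      ring
    · zify
      rw [mul_pow, hx]
      ring
  · exact ⟨u, 0, v, w, by ring, u, by ring⟩

/-! ### Squares of the form `x + 2 y`: large numbers -/

lemma exists_sq_add_sq_eq_five_mul {b c : ℤ} (h : 5 ∣ b ^ 2 + c ^ 2) :
    ∃ v w : ℤ, b ^ 2 + c ^ 2 = 5 * (v ^ 2 + w ^ 2) := by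
  have h5 : (5 : ℤ) ∣ (b - 2 * c) * (b + 2 * c) := by
    have : (b - 2 * c) * (b + 2 * c) = b ^ 2 + c ^ 2 - 5 * c ^ 2 := by ring
    rw [this]
    exact dvd_sub h (dvd_mul_right _ _)
  rcases (by norm_num : Prime (5 : ℤ)).dvd_or_dvd h5 with ⟨j, hj⟩ | ⟨j, hj⟩
  · exact ⟨c + 2 * j, j, by rw [show b = 2 * c + 5 * j by omega]; ring⟩
  · exact ⟨c - 2 * j, j, by rw [show b = -2 * c + 5 * j by omega]; ring⟩

lemma exists_sq_add_five_mul {m A B C : ℤ} (h : m = A ^ 2 + B ^ 2 + C ^ 2)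
    (hm : m % 5 = 0 ∨ m % 5 = 4) :
    ∃ u v w : ℤ, m = u ^ 2 + 5 * (v ^ 2 + w ^ 2) := by
  have sq5 : ∀ a : ℤ, a ^ 2 % 5 = 0 ∨ a ^ 2 % 5 = 1 ∨ a ^ 2 % 5 = 4 := by
    intro a
    rcases (by omega : a % 5 = 0 ∨ a % 5 = 1 ∨ a % 5 = 2 ∨ a % 5 = 3 ∨ a % 5 = 4) with
      h | h | h | h | h <;> simp [pow_two, Int.mul_emod, h]
  have hA := sq5 A
  have hB := sq5 B
  have hC := sq5 C
  rcases (by omega : 5 ∣ B ^ 2 + C ^ 2 ∨ 5 ∣ A ^ 2 + C ^ 2 ∨ 5 ∣ A ^ 2 + B ^ 2) with h5 | h5 | h5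
  · obtain ⟨v, w, hvw⟩ := exists_sq_add_sq_eq_five_mul h5
    exact ⟨A, v, w, by rw [← hvw, h]; ring⟩
  · obtain ⟨v, w, hvw⟩ := exists_sq_add_sq_eq_five_mul h5
    exact ⟨B, v, w, by rw [← hvw, h]; ring⟩
  · obtain ⟨v, w, hvw⟩ := exists_sq_add_sq_eq_five_mul h5
    exact ⟨C, v, w, by rw [← hvw, h]; ring⟩

/-- If `4 n ≤ k ^ 4` and `5 n - k ^ 4 = u² + 5 v² + 5 w²`, then `|u| ≤ k² / 2`, and for the right
sign of `u` the numbers `x = (k² + 2 u) / 5` and `y = (2 k² - u) / 5` are natural numbers with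
`5 (x² + y²) = k ^ 4 + u²`. -/
lemma exists_sum_four_sq_of_sum_three_sq {n k : ℤ} (hk : 4 * n ≤ k ^ 4) {A B C : ℤ}
    (h : 5 * n - k ^ 4 = A ^ 2 + B ^ 2 + C ^ 2) :
    ∃ x y z w : ℤ, n = x ^ 2 + y ^ 2 + z ^ 2 + w ^ 2 ∧ 0 ≤ x ∧ 0 ≤ y ∧ x + 2 * y = k ^ 2 := by
  have hk5 : k ^ 4 % 5 = 0 ∨ k ^ 4 % 5 = 1 := by
    rcases (by omega : k % 5 = 0 ∨ k % 5 = 1 ∨ k % 5 = 2 ∨ k % 5 = 3 ∨ k % 5 = 4) with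
      h | h | h | h | h <;> simp [pow_succ, Int.mul_emod, h]
  obtain ⟨u, v, w, huvw⟩ := exists_sq_add_five_mul h (by omega)
  have hu : |2 * u| ≤ k ^ 2 := by
    refine abs_le_of_sq_le_sq ?_ (by positivity)
    linarith [sq_nonneg v, sq_nonneg w]
  obtain ⟨j, hj, huj⟩ : ∃ j, (2 * k ^ 2 + 5 * j) ^ 2 = u ^ 2 ∧
      |2 * (2 * k ^ 2 + 5 * j)| ≤ k ^ 2 := by
    have h5 : (5 : ℤ) ∣ (u - 2 * k ^ 2) * (u + 2 * k ^ 2) :=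
      ⟨n - k ^ 4 - v ^ 2 - w ^ 2, by linear_combination -huvw⟩
    rcases (by norm_num : Prime (5 : ℤ)).dvd_or_dvd h5 with ⟨j, hj⟩ | ⟨j, hj⟩
    · have : 2 * k ^ 2 + 5 * j = u := by omega
      exact ⟨j, by rw [this], by rwa [this]⟩
    · have : 2 * k ^ 2 + 5 * -j = -u := by omega
      exact ⟨-j, by rw [this, neg_sq], by rwa [this, mul_neg, abs_neg]⟩
  rw [abs_le] at huj
  refine ⟨k ^ 2 + 2 * j, -j, v, w, by linarith, by linarith, ?_, by ring⟩
  linarith [sq_nonneg k]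

lemma sum_three_sq_of_mod_sixteen {m : ℕ} (h0 : m % 16 ≠ 0) (h12 : m % 16 ≠ 12)
    (h7 : m % 8 ≠ 7) : ∃ u v w : ℕ, m = u ^ 2 + v ^ 2 + w ^ 2 := by
  refine (eq_four_pow_mul_or_sum_three_sq m).resolve_left ?_
  rintro ⟨_ | _ | a, b, rfl⟩
  · omega
  · omega
  · rw [show 4 ^ (a + 1 + 1) * (8 * b + 7) = 16 * (4 ^ a * (8 * b + 7)) by ring] at h0
    exact h0 (Nat.mul_mod_right _ _)

/-- The bound `419905 = 36 ^ 4 / 4 + 1` forces the least `k` of the given parity with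
`4 n ≤ k ^ 4` to be at least `37`, and `4 * 37 ^ 4 ≤ 5 * 35 ^ 4`. -/
lemma exists_pow_four_between {n r : ℕ} (hr : r < 2) (hn : 419905 ≤ n) :
    ∃ k, k % 2 = r ∧ 4 * n ≤ k ^ 4 ∧ k ^ 4 ≤ 5 * n := by
  have hex : ∃ j, 4 * n ≤ (2 * j + r) ^ 4 := by
    refine ⟨4 * n, ?_⟩
    calc 4 * n ≤ 2 * (4 * n) + r := by omega
      _ ≤ (2 * (4 * n) + r) ^ 4 := Nat.le_self_pow (by norm_num) _
  classical
  set j := Nat.find hex with hj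
  have hle : 4 * n ≤ (2 * j + r) ^ 4 := Nat.find_spec hex
  have h37 : 37 ≤ 2 * j + r := by
    by_contra! hlt
    have : (2 * j + r) ^ 4 ≤ 36 ^ 4 := Nat.pow_le_pow_left (by omega) 4
    omega
  have hlt : (2 * (j - 1) + r) ^ 4 < 4 * n := not_le.1 (Nat.find_min hex (by omega))
  obtain ⟨i, hi⟩ := Nat.exists_eq_add_of_le h37
  rw [show 2 * (j - 1) + r = 35 + i by omega] at hlt
  refine ⟨2 * j + r, by omega, hle, ?_⟩
  rw [hi]
  have : 4 * (37 + i) ^ 4 ≤ 5 * (35 + i) ^ 4 := by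
    ring_nf
    gcongr <;> norm_num
  omega

lemma exists_sum_four_sq_of_large {n : ℕ} (hn : 419905 ≤ n) (h16 : n % 16 ≠ 0) :
    ∃ x y z w : ℕ, n = x ^ 2 + y ^ 2 + z ^ 2 + w ^ 2 ∧
      ∃ k : ℕ, 0 < k ∧ x + 2 * y = k ^ 2 := by
  have hk4 : ∀ k : ℕ, k ^ 4 % 16 = k % 2 := by
    intro k
    have : k % 16 < 16 := Nat.mod_lt _ (by norm_num)
    rw [Nat.pow_mod, ← Nat.mod_mod_of_dvd k (by norm_num : 2 ∣ 16)]
    interval_cases k % 16 <;> rfl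
  obtain ⟨k, hk, hk', h0, h12, h7⟩ : ∃ k, 4 * n ≤ k ^ 4 ∧ k ^ 4 ≤ 5 * n ∧
      (5 * n - k ^ 4) % 16 ≠ 0 ∧ (5 * n - k ^ 4) % 16 ≠ 12 ∧ (5 * n - k ^ 4) % 8 ≠ 7 := by
    -- Fourth powers are `0` or `1` modulo `16`, so only the parity of `k` matters here.
    by_cases h : 5 * n % 16 = 7 ∨ 5 * n % 16 = 15 ∨ 5 * n % 16 = 12
    · obtain ⟨k, h1, h2, h3⟩ := exists_pow_four_between (r := 1) (by norm_num) hn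
      have := hk4 k
      exact ⟨k, h2, h3, by omega⟩
    · obtain ⟨k, h1, h2, h3⟩ := exists_pow_four_between (r := 0) (by norm_num) hn
      have := hk4 k
      exact ⟨k, h2, h3, by omega⟩
  obtain ⟨A, B, C, hABC⟩ := sum_three_sq_of_mod_sixteen h0 h12 h7
  obtain ⟨x, y, z, w, hsum, hx, hy, hxy⟩ :=
    exists_sum_four_sq_of_sum_three_sq (n := n) (k := k) (A := A) (B := B) (C := C)
      (by exact_mod_cast hk) (by zify [hk'] at hABC; exact hABC)
  lift x to ℕ using hx
  lift y to ℕ using hy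
  refine ⟨x, y, z.natAbs, w.natAbs, ?_, k, ?_, by exact_mod_cast hxy⟩
  · zify
    simpa only [sq_abs] using hsum
  · rcases Nat.eq_zero_or_pos k with rfl | h
    · omega
    · exact h

/-! ### Squares of the form `x + 2 y`: small numbers -/

/-- Finite sets of natural numbers are encoded as the sets of nonzero binary digits of natural
numbers. If `M` encodes `S`, then `shiftUnion M f m` encodes `{s + f i | s ∈ S, i < m}`. -/
def shiftUnion (M : ℕ) (f : ℕ → ℕ) : ℕ → ℕ
  | 0 => 0
  | m + 1 => shiftUnion M f m ||| M <<< f m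

lemma exists_of_testBit_shiftUnion {M : ℕ} {f : ℕ → ℕ} {m n : ℕ}
    (h : (shiftUnion M f m).testBit n) : ∃ i < m, ∃ s, M.testBit s ∧ n = s + f i := by
  induction m with
  | zero => simp [shiftUnion] at h
  | succ m ih =>
    rw [shiftUnion, Nat.testBit_or, Bool.or_eq_true, Nat.testBit_shiftLeft, Bool.and_eq_true,
      decide_eq_true_iff] at h
    rcases h with h | ⟨h1, h2⟩
    · obtain ⟨i, hi, s, hs⟩ := ih h
      exact ⟨i, by omega, s, hs⟩
    · exact ⟨m, by omega, _, h2, by omega⟩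

/-- Binary encoding of the set of `z² + w²` with `z, w < 649`; note `648² ≤ 419904 < 649²`. -/
def twoSquaresMask : ℕ := shiftUnion (shiftUnion 1 (fun i => i * i) 649) (fun i => i * i) 649

/-- Binary encoding of the set of `x² + y² + s` with `x + 2 y = k²`, `1 ≤ k ≤ K` and `s` in the set
encoded by `twoSquaresMask`. The subtraction in `x = k² - 2 y` is exact since `y ≤ k² / 2`. -/
def squareLineMask : ℕ → ℕ
  | 0 => 0
  | k + 1 => squareLineMask k |||
      shiftUnion twoSquaresMask (fun y => ((k + 1) ^ 2 - 2 * y) ^ 2 + y ^ 2) ((k + 1) ^ 2 / 2 + 1)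

/-- Binary encoding of the multiples of `16` below `16 * 163 ^ 2`, written as `16 i + 16 * 163 j`
to keep the recursion shallow. -/
def sixteenMask : ℕ := shiftUnion (shiftUnion 1 (fun i => 16 * i) 163) (fun i => 2608 * i) 163

/-- Every `n < 419905` is a multiple of `16` or has a representation with `k ≤ 10`; the kernel
checks this with a few hundred bitwise operations on long integers. -/
lemma squareLineMask_or_sixteenMask_mod :
    (squareLineMask 10 ||| sixteenMask) % 2 ^ 419905 = 2 ^ 419905 - 1 := by
  decide +kernel

lemma exists_of_testBit_shiftUnion_one {f : ℕ → ℕ} {m n : ℕ}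
    (h : (shiftUnion 1 f m).testBit n) : ∃ i, n = f i := by
  obtain ⟨i, -, s, hs, rfl⟩ := exists_of_testBit_shiftUnion h
  rw [Nat.testBit_one_eq_true_iff_self_eq_zero] at hs
  exact ⟨i, by rw [hs, zero_add]⟩

lemma exists_of_testBit_twoSquaresMask {s : ℕ} (h : twoSquaresMask.testBit s) :
    ∃ z w : ℕ, s = z ^ 2 + w ^ 2 := by
  obtain ⟨w, -, t, ht, hs⟩ := exists_of_testBit_shiftUnion h
  obtain ⟨z, hz⟩ := exists_of_testBit_shiftUnion_one ht
  exact ⟨z, w, by rw [hs, hz, pow_two, pow_two]⟩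

lemma exists_of_testBit_squareLineMask {n K : ℕ} (h : (squareLineMask K).testBit n) :
    ∃ x y z w : ℕ, n = x ^ 2 + y ^ 2 + z ^ 2 + w ^ 2 ∧
      ∃ k : ℕ, 0 < k ∧ x + 2 * y = k ^ 2 := by
  induction K with
  | zero => simp [squareLineMask] at h
  | succ K ih =>
    rw [squareLineMask, Nat.testBit_or, Bool.or_eq_true] at h
    rcases h with h | h
    · exact ih h
    · obtain ⟨y, hy, s, hs, rfl⟩ := exists_of_testBit_shiftUnion h
      obtain ⟨z, w, rfl⟩ := exists_of_testBit_twoSquaresMask hs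
      exact ⟨(K + 1) ^ 2 - 2 * y, y, z, w, by ring, K + 1, K.succ_pos, by omega⟩

lemma mod_sixteen_of_testBit_sixteenMask {n : ℕ} (h : sixteenMask.testBit n) : n % 16 = 0 := by
  obtain ⟨i, -, t, ht, hn⟩ := exists_of_testBit_shiftUnion h
  obtain ⟨j, hj⟩ := exists_of_testBit_shiftUnion_one ht
  omega

lemma testBit_of_mod_two_pow_eq {m n N : ℕ} (h : m % 2 ^ N = 2 ^ N - 1) (hn : n < N) :
    m.testBit n := by
  have h1 : (m % 2 ^ N).testBit n := by
    rw [h, Nat.testBit_two_pow_sub_one]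
    exact decide_eq_true hn
  rw [Nat.testBit_mod_two_pow, Bool.and_eq_true] at h1
  exact h1.2

lemma exists_sum_four_sq_of_small {n : ℕ} (hn : n < 419905) (h16 : n % 16 ≠ 0) :
    ∃ x y z w : ℕ, n = x ^ 2 + y ^ 2 + z ^ 2 + w ^ 2 ∧
      ∃ k : ℕ, 0 < k ∧ x + 2 * y = k ^ 2 := by
  have h := testBit_of_mod_two_pow_eq squareLineMask_or_sixteenMask_mod hn
  rw [Nat.testBit_or, Bool.or_eq_true] at h
  rcases h with h | h
  · exact exists_of_testBit_squareLineMask h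
  · exact absurd (mod_sixteen_of_testBit_sixteenMask h) h16

/-! ### The two representation theorems -/

theorem exists_sum_four_sq_add_two_mul_eq_sq (n : ℕ) (hn : 0 < n) :
    ∃ x y z w : ℕ, n = x ^ 2 + y ^ 2 + z ^ 2 + w ^ 2 ∧
      ∃ k : ℕ, 0 < k ∧ x + 2 * y = k ^ 2 := by
  induction n using Nat.strong_induction_on with
  | _ n ih =>
    by_cases h16 : n % 16 = 0
    · obtain ⟨m, rfl⟩ := Nat.dvd_of_mod_eq_zero h16
      obtain ⟨x, y, z, w, rfl, k, hk, hxy⟩ := ih m (by omega) (by omega)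
      exact ⟨4 * x, 4 * y, 4 * z, 4 * w, by ring, 2 * k, by omega, by
        linear_combination 4 * hxy⟩
    · rcases lt_or_ge n 419905 with h | h
      · exact exists_sum_four_sq_of_small h h16
      · exact exists_sum_four_sq_of_large h h16

open MvPolynomial in
theorem theorem1p1 :
    -- part (i), followed by its explicit form
    (IsSuitable (X 0 ^ 2 + 8 * X 1 * X 2) ∧
      ∀ n : ℕ, ∃ x y z w : ℕ, n = x ^ 2 + y ^ 2 + z ^ 2 + w ^ 2 ∧
        IsSquare (x ^ 2 + 8 * y * z)) ∧
    -- part (ii)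
    (IsSuitable (X 0 + 2 * X 1) ∧
      ∀ n : ℕ, 0 < n → ∃ x y z w : ℕ, n = x ^ 2 + y ^ 2 + z ^ 2 + w ^ 2 ∧
        ∃ k : ℕ, 0 < k ∧ x + 2 * y = k ^ 2) := by
  refine ⟨⟨fun n => ?_, exists_sum_four_sq_isSquare_sq_add_eight_mul⟩,
    fun n => ?_, exists_sum_four_sq_add_two_mul_eq_sq⟩
  · obtain ⟨x, y, z, w, h, s, hs⟩ := exists_sum_four_sq_isSquare_sq_add_eight_mul n
    refine ⟨x, y, z, w, h, s, ?_⟩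
    rw [show (8 : MvPolynomial (Fin 4) ℤ) = C 8 from rfl]
    simp only [map_add, map_mul, map_pow, eval_X, eval_C, Matrix.cons_val]
    exact_mod_cast hs
  · rcases Nat.eq_zero_or_pos n with rfl | hn
    · exact ⟨0, 0, 0, 0, rfl, 0, by simp⟩
    obtain ⟨x, y, z, w, h, k, -, hk⟩ := exists_sum_four_sq_add_two_mul_eq_sq n hn
    refine ⟨x, y, z, w, h, k, ?_⟩
    rw [show (2 : MvPolynomial (Fin 4) ℤ) = C 2 from rfl]
    simp only [map_add, map_mul, eval_X, eval_C, Matrix.cons_val]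
    rw [← pow_two]
    exact_mod_cast hk
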